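/- Conventions. A hyperbolic triangle is a non-degenerate geodesic triangle in the hyperbolic plane $\mathbf H^2$ (its vertices do not lie on one geodesic). Its circumcircle is the complete curve of constant geodesic curvature through its three vertices (in the upper half-plane model: the intersection of $\mathbf H^2$ with the Euclidean circle or line through them); it is a hyperbolic circle, a horocycle, or a curve of constant distance to a geodesic. Its circumball is the closed region bounded by the circumcircle that is geodesically convex. A closed hyperbolic polyhedral surface $(S,V,d)$ is a connected metric space obtained from a finite disjoint union of hyperbolic triangles by identifying all their edges in pairs by isometries (two edges of the same triangle may be identified), with the quotient metric $d$, such that $V$ is the image of the set of vertices; any such presentation of $(S,V,d)$ is called a geodesic triangulation $\mathcal T$ of $(S,V,d)$. A geodesic triangulation $\mathcal T$ is Delaunay if for each edge $e$, with adjacent triangles $t$ and $t'$ (the one or two triangles that have $e$ as a side), whenever $t\cup_e t'$ is lifted to $\mathbf H^2$ as two triangles on opposite sides of their common edge, the interior of the circumball of $t$ contains no vertex of $t'$ (and likewise with $t$ and $t'$ exchanged). Theorem. Let $(S,V,d)$ be a closed hyperbolic polyhedral surface and let $\mathcal T$ be a Delaunay triangulation of $(S,V,d)$. Then every triangle of $\mathcal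 T$ has a compact circumcircle; that is, its circumcircle is a hyperbolic circle $\{z\in\mathbf H^2 : d_{\mathbf H^2}(z,p)=r\}$ with some centre $p\in\mathbf H^2$ and radius $r>0$, and not a horocycle or a curve of constant distance to a geodesic. -/

import Mathlib

open scoped UpperHalfPlane

namespace HyperbolicPolyhedral

/-! The hyperbolic plane is Mathlib's upper half-plane `ℍ` with its hyperbolic distance. -/

/-- The closed geodesic segment with end points `x` and `y`. -/
def segment (x y : ℍ) : Set ℍ := {z | dist x z + dist z y = dist x y}

/-- The complete geodesic line through two distinct points `x` and `y`. -/
def line (x y : ℍ) : Set ℍ := {z | z ∈ segment x y ∨ x ∈ segment z y ∨ y ∈ segment x z}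

/-- Geodesic convexity. -/
def IsConvex (B : Set ℍ) : Prop := ∀ x ∈ B, ∀ y ∈ B, segment x y ⊆ B

/-- For `x, y` not on the line through `a` and `b`: `x` and `y` lie on opposite sides of it. -/
def OppositeSides (a b x y : ℍ) : Prop := (line a b ∩ segment x y).Nonempty

/-- A hyperbolic triangle, given by its three vertices, which do not lie on a common geodesic
(equivalently, the three strict triangle inequalities hold). The edge `i` is the edge opposite to
the vertex `i`. -/
structure Triangle where
  vertex : Fin 3 → ℍ
  nondegenerate : ∀ i j k : Fin 3, i ≠ j → j ≠ k → i ≠ k →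
    dist (vertex i) (vertex k) < dist (vertex i) (vertex j) + dist (vertex j) (vertex k)

namespace Triangle

/-- The edge opposite to the vertex `i`. -/
def edge (T : Triangle) (i : Fin 3) : Set ℍ := segment (T.vertex (i + 1)) (T.vertex (i + 2))

/-- The (filled) triangle: the convex hull of the three vertices. -/
def region (T : Triangle) : Set ℍ := ⋂ (B : Set ℍ) (_ : IsConvex B) (_ : Set.range T.vertex ⊆ B), B

end Triangle

/-- The left-hand side of the equation `a * |z| ^ 2 + b * re z + c * im z + d = 0` of a Euclidean
circle or Euclidean line. -/
def cycleForm (a b c d : ℝ) (z : ℍ) : ℝ :=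
  a * Complex.normSq (z : ℂ) + b * z.re + c * z.im + d

namespace Triangle

/-- `C` is the circumcircle of `T`, the complete curve of constant geodesic curvature through the
vertices. In the upper half-plane these curves (geodesics, hyperbolic circles, horocycles, curves
of constant distance to a geodesic) are exactly the non-empty intersections of `ℍ` with Euclidean
circles and Euclidean lines. -/
def IsCircumcircle (T : Triangle) (C : Set ℍ) : Prop :=
  ∃ a b c d : ℝ, ¬ (a = 0 ∧ b = 0 ∧ c = 0 ∧ d = 0) ∧
    (∀ i, cycleForm a b c d (T.vertex i) = 0) ∧ C = {z | cycleForm a b c d z = 0}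

/-- `B` is the circumball of `T`: of the two closed regions bounded by the circumcircle, the one
that is convex. The other region is obtained by changing the signs of `a, b, c, d`. -/
def IsCircumball (T : Triangle) (B : Set ℍ) : Prop :=
  (∃ a b c d : ℝ, ¬ (a = 0 ∧ b = 0 ∧ c = 0 ∧ d = 0) ∧
    (∀ i, cycleForm a b c d (T.vertex i) = 0) ∧ B = {z | cycleForm a b c d z ≤ 0}) ∧
  IsConvex B

end Triangle

/-- A finite disjoint union of hyperbolic triangles together with an isometric identification of
their edges in pairs. The edge `i` of the triangle `t` is glued to the edge `perm t i i` of the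
triangle `next t i`, in such a way that the end point `j ≠ i` goes to the end point
`perm t i j`. Two edges of the same triangle may be glued to each other. -/
structure Gluing where
  Face : Type
  finite_face : Finite Face
  tri : Face → Triangle
  next : Face → Fin 3 → Face
  perm : Face → Fin 3 → Equiv.Perm (Fin 3)
  next_next : ∀ t i, next (next t i) (perm t i i) = t
  perm_perm : ∀ t i, perm (next t i) (perm t i i) = (perm t i)⁻¹
  /-- No edge is glued to itself. -/
  not_self : ∀ t i, next t i = t → perm t i i ≠ i
  /-- Glued edges have the same length. -/
  isometric : ∀ t i j k, j ≠ i → k ≠ i →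
    dist ((tri t).vertex j) ((tri t).vertex k) =
      dist ((tri (next t i)).vertex (perm t i j)) ((tri (next t i)).vertex (perm t i k))

namespace Gluing

variable (G : Gluing)

/-- The disjoint union of the triangles. -/
def Points : Type := Σ t : G.Face, {z : ℍ // z ∈ (G.tri t).region}

/-- `p`, on an edge of a triangle, is identified with the point `q` of the edge glued to it: the
point that corresponds to `p` under the isometry of the two edges. -/
def Identified (p q : G.Points) : Prop :=
  ∃ i : Fin 3, q.1 = G.next p.1 i ∧
    (p.2 : ℍ) ∈ (G.tri p.1).edge i ∧ (q.2 : ℍ) ∈ (G.tri q.1).edge (G.perm p.1 i i) ∧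
    ∀ j, j ≠ i →
      dist (p.2 : ℍ) ((G.tri p.1).vertex j) = dist (q.2 : ℍ) ((G.tri q.1).vertex (G.perm p.1 i j))

/-- The glued surface. -/
def Surface : Type := Quot G.Identified

/-- The image in the surface of the point `z` of the triangle `t`. -/
def point (t : G.Face) (z : {z : ℍ // z ∈ (G.tri t).region}) : G.Surface :=
  Quot.mk G.Identified ⟨t, z⟩

/-- The vertices of the triangulation. -/
def vertexSet : Set G.Surface := {p | ∃ t z i, z.1 = (G.tri t).vertex i ∧ p = G.point t z}

/-- `G.Chain p q l`: there is a chain of geodesic segments from `p` to `q`, each contained in one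
triangle, of total length `l`. -/
inductive Chain : G.Surface → G.Surface → ℝ → Prop
  | refl (p : G.Surface) : Chain p p 0
  | step (p : G.Surface) (l : ℝ) (t : G.Face) (x y : {z : ℍ // z ∈ (G.tri t).region}) :
      Chain p (G.point t x) l → Chain p (G.point t y) (l + dist (x : ℍ) (y : ℍ))

/-- The isometry `g` of `ℍ` lifts the quadrilateral associated to the edge `i` of the triangle `t`
to the hyperbolic plane: it moves the triangle on the other side of this edge next to `t`, so that
the common edge matches and the two triangles lie on opposite sides of it. -/
def IsLift (t : G.Face) (i : Fin 3) (g : ℍ ≃ᵢ ℍ) : Prop :=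
  (∀ j, j ≠ i → g ((G.tri (G.next t i)).vertex (G.perm t i j)) = (G.tri t).vertex j) ∧
  OppositeSides ((G.tri t).vertex (i + 1)) ((G.tri t).vertex (i + 2)) ((G.tri t).vertex i)
    (g ((G.tri (G.next t i)).vertex (G.perm t i i)))

end Gluing

/-- A geodesic triangulation of `(S, V, d)`: the space `S` is, as a metric space, the quotient of
a finite disjoint union of hyperbolic triangles under isometric identifications of edges in pairs,
with the quotient metric, and `V` is the set of vertices. Such a space is compact and is a
surface without boundary. -/
structure GeodesicTriangulation (S : Type*) [MetricSpace S] (V : Set S) extends Gluing where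
  toSurface : toGluing.Surface ≃ S
  /-- The distance of `S` is the quotient distance. -/
  isGLB_dist : ∀ p q, IsGLB {l | toGluing.Chain p q l} (dist (toSurface p) (toSurface q))
  image_vertexSet : toSurface '' toGluing.vertexSet = V

/-- `(S, V, d)` is a closed (connected) hyperbolic polyhedral surface. -/
def IsClosedHyperbolicPolyhedralSurface (S : Type*) [MetricSpace S] (V : Set S) : Prop :=
  ConnectedSpace S ∧ Nonempty (GeodesicTriangulation S V)

/-- The empty ball condition: for each edge of each triangle `t`, when the quadrilateral
associated to the edge is lifted to the hyperbolic plane, the interior of the circumball of `t`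
contains no vertex of the adjacent triangle. The circumball and the lift next to `t` always exist
and are unique. -/
def GeodesicTriangulation.IsDelaunay {S : Type*} [MetricSpace S] {V : Set S}
    (T : GeodesicTriangulation S V) : Prop :=
  ∀ (t : T.Face) (i : Fin 3), ∃ (B : Set ℍ) (g : ℍ ≃ᵢ ℍ),
    (T.tri t).IsCircumball B ∧ T.toGluing.IsLift t i g ∧
    ∀ k, g ((T.tri (T.next t i)).vertex k) ∉ interior B

end HyperbolicPolyhedral

namespace HyperbolicPolyhedral

/-! ### Hyperboloid coordinates -/

/-! On the hyperboloid `p * r = q ^ 2 + 1` cycles are plane sections, and `2 * sinh (dist / 2)` is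
the Minkowski length of a chord. The plane through three vertices cuts out a hyperbolic circle
exactly when the three chords satisfy the strict Euclidean triangle inequalities. So a non-compact
circumcircle means a long side (`IsLongSide`): its half-distance `sinh` is at least the sum of the
other two.

The core is `isLongSide_of_delaunay`. Let `x y` be a long side of a Delaunay triangle with third
vertex `u`. The cycles through `x` and `y` form a pencil spanned by `diamForm` and `lineForm`. Since
`u` lies inside the disc with diameter `x y`, the empty ball condition forces the vertex `v` across
`x y` so far out that the triangle `v x y` has a long side too, and it is not `x y`. A long side is
strictly longer than the others, so this one is longer than `x y`. Among finitely many triangles a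
longest long side would exist, a contradiction. Without long sides the discriminant of the
circumcircle is negative, and completing the square exhibits its centre. -/

/-- The first hyperboloid coordinate of a point of the upper half-plane. -/
noncomputable def coordP (z : ℍ) : ℝ := 1 / z.im

/-- The second hyperboloid coordinate of a point of the upper half-plane. -/
noncomputable def coordQ (z : ℍ) : ℝ := z.re / z.im

/-- The third hyperboloid coordinate of a point of the upper half-plane. -/
noncomputable def coordR (z : ℍ) : ℝ := (z.re ^ 2 + z.im ^ 2) / z.im

theorem coordP_pos (z : ℍ) : 0 < coordP z := one_div_pos.2 z.im_pos

theorem coordP_mul_coordR (z : ℍ) : coordP z * coordR z = coordQ z ^ 2 + 1 := by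
  have := z.im_pos.ne'
  unfold coordP coordQ coordR
  field_simp

theorem cosh_dist_eq_coord (z w : ℍ) : Real.cosh (dist z w) =
    (coordP z * coordR w + coordP w * coordR z) / 2 - coordQ z * coordQ w := by
  have := z.im_pos.ne'
  have := w.im_pos.ne'
  rw [UpperHalfPlane.cosh_dist']
  unfold coordP coordQ coordR
  field_simp
  ring

/-- Dividing by `z.im > 0` makes the cycle form affine in the coordinates without changing its sign.
-/
theorem cycleForm_eq_coord (a b c d : ℝ) (z : ℍ) : cycleForm a b c d z =
    z.im * (a * coordR z + b * coordQ z + c + d * coordP z) := by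
  have := z.im_pos.ne'
  unfold cycleForm coordP coordQ coordR
  rw [Complex.normSq_apply, UpperHalfPlane.coe_re, UpperHalfPlane.coe_im]
  field_simp

theorem exists_coord {p q r : ℝ} (hp : 0 < p) (h : p * r = q ^ 2 + 1) :
    ∃ z : ℍ, coordP z = p ∧ coordQ z = q ∧ coordR z = r := by
  refine ⟨⟨⟨q / p, 1 / p⟩, by positivity⟩, ?_, ?_, ?_⟩
  · simp [coordP, UpperHalfPlane.im]
  · simp only [coordQ, UpperHalfPlane.im, UpperHalfPlane.re]
    field_simp
  · simp only [coordR, UpperHalfPlane.im, UpperHalfPlane.re]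
    field_simp
    linarith

/-- A vector that is isotropic and orthogonal to a point of the hyperboloid vanishes. -/
theorem eq_zero_of_isotropic_of_orthogonal {p q r a b c : ℝ} (hp : 0 < p) (h : p * r = q ^ 2 + 1)
    (h₁ : b ^ 2 = a * c) (h₂ : (p * c + a * r) / 2 = q * b) : a = 0 ∧ b = 0 ∧ c = 0 := by
  -- The Minkowski form is definite on the complement of a timelike vector; this is the sum of
  -- squares that shows it.
  have key : (p * b - q * a) ^ 2 + a ^ 2 = 0 := by
    linear_combination p ^ 2 * h₁ + 2 * p * a * h₂ - a ^ 2 * h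
  have ha : a = 0 := by nlinarith [sq_nonneg (p * b - q * a), sq_nonneg a]
  subst ha
  have hb : b = 0 := by nlinarith [sq_nonneg b]
  subst hb
  refine ⟨rfl, rfl, ?_⟩
  have : p * c = 0 := by linarith
  simpa [hp.ne'] using this

/-- A point of a segment is a combination of the end points with nonnegative coefficients. -/
theorem sinh_mul_coord_of_mem_segment {x y z : ℍ} (h : z ∈ segment x y) :
    Real.sinh (dist x y) * coordP z =
        Real.sinh (dist z y) * coordP x + Real.sinh (dist x z) * coordP y ∧
      Real.sinh (dist x y) * coordQ z =
        Real.sinh (dist z y) * coordQ x + Real.sinh (dist x z) * coordQ y ∧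
      Real.sinh (dist x y) * coordR z =
        Real.sinh (dist z y) * coordR x + Real.sinh (dist x z) * coordR y := by
  have h : dist x z + dist z y = dist x y := h
  have hxz := cosh_dist_eq_coord x z
  have hzy := cosh_dist_eq_coord z y
  have hxy := cosh_dist_eq_coord x y
  rw [← h] at hxy ⊢
  generalize dist x z = s at *
  generalize dist z y = t at *
  have hs := Real.cosh_sq s
  have ht := Real.cosh_sq t
  rw [Real.cosh_add] at hxy
  rw [Real.sinh_add]
  generalize Real.cosh s = cs at *
  generalize Real.cosh t = ct at *
  generalize Real.sinh s = ss at *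
  generalize Real.sinh t = st at *
  have hx := coordP_mul_coordR x
  have hy := coordP_mul_coordR y
  have hz := coordP_mul_coordR z
  -- The defect of the claimed combination is orthogonal to `x`, `y` and `z`. Being itself a
  -- combination of them, it is isotropic, hence zero.
  have ox : ((coordP x * ((ss * ct + cs * st) * coordR z - (st * coordR x + ss * coordR y)) +
      ((ss * ct + cs * st) * coordP z - (st * coordP x + ss * coordP y)) * coordR x)) / 2 =
      coordQ x * ((ss * ct + cs * st) * coordQ z - (st * coordQ x + ss * coordQ y)) := by
    linear_combination -(ss * ct + cs * st) * hxz + ss * hxy - st * hx + st * hs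
  have oy : ((coordP y * ((ss * ct + cs * st) * coordR z - (st * coordR x + ss * coordR y)) +
      ((ss * ct + cs * st) * coordP z - (st * coordP x + ss * coordP y)) * coordR y)) / 2 =
      coordQ y * ((ss * ct + cs * st) * coordQ z - (st * coordQ x + ss * coordQ y)) := by
    linear_combination -(ss * ct + cs * st) * hzy + st * hxy - ss * hy + ss * ht
  have oz : ((coordP z * ((ss * ct + cs * st) * coordR z - (st * coordR x + ss * coordR y)) +
      ((ss * ct + cs * st) * coordP z - (st * coordP x + ss * coordP y)) * coordR z)) / 2 =
      coordQ z * ((ss * ct + cs * st) * coordQ z - (st * coordQ x + ss * coordQ y)) := by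
    linear_combination (ss * ct + cs * st) * hz + st * hxz + ss * hzy
  obtain ⟨h1, h2, h3⟩ := eq_zero_of_isotropic_of_orthogonal (coordP_pos x) hx
    (a := (ss * ct + cs * st) * coordP z - (st * coordP x + ss * coordP y))
    (b := (ss * ct + cs * st) * coordQ z - (st * coordQ x + ss * coordQ y))
    (c := (ss * ct + cs * st) * coordR z - (st * coordR x + ss * coordR y))
    (by linear_combination -(ss * ct + cs * st) * oz + st * ox + ss * oy) ox
  exact ⟨sub_eq_zero.1 h1, sub_eq_zero.1 h2, sub_eq_zero.1 h3⟩

/-! ### The two affine forms that vanish at two given points -/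

/-- A linear form that vanishes exactly on the line through `x` and `y`. -/
noncomputable def lineForm (x y z : ℍ) : ℝ :=
  (coordR z * (coordP x * coordQ y - coordQ x * coordP y) +
    coordQ z * (coordR x * coordP y - coordP x * coordR y) +
    coordP z * (coordQ x * coordR y - coordR x * coordQ y)) / 2

/-- The affine form that defines the disc with diameter `x y`. -/
noncomputable def diamForm (x y z : ℍ) : ℝ :=
  Real.cosh (dist z x) + Real.cosh (dist z y) - 1 - Real.cosh (dist x y)

/-- `lineForm` is half the determinant of the three coordinate vectors, so its square is their Gram
determinant. -/
theorem lineForm_sq (x y z : ℍ) : lineForm x y z ^ 2 =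
    1 + 2 * Real.cosh (dist x y) * Real.cosh (dist z x) * Real.cosh (dist z y)
      - Real.cosh (dist x y) ^ 2 - Real.cosh (dist z x) ^ 2 - Real.cosh (dist z y) ^ 2 := by
  simp only [UpperHalfPlane.cosh_dist']
  unfold lineForm coordP coordQ coordR
  have := x.im_pos.ne'
  have := y.im_pos.ne'
  have := z.im_pos.ne'
  field_simp
  ring

theorem one_add_two_mul_cosh_eq (s t u : ℝ) :
    1 + 2 * Real.cosh s * Real.cosh t * Real.cosh u - Real.cosh s ^ 2 - Real.cosh t ^ 2
      - Real.cosh u ^ 2 =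
    (Real.cosh (s + t) - Real.cosh u) * (Real.cosh u - Real.cosh (s - t)) := by
  rw [Real.cosh_add, Real.cosh_sub]
  linear_combination Real.sinh t ^ 2 * Real.cosh_sq s + (Real.cosh s ^ 2 - 1) * Real.cosh_sq t

theorem lineForm_eq_zero_of_mem_line {x y z : ℍ} (h : z ∈ line x y) : lineForm x y z = 0 := by
  rw [← sq_eq_zero_iff, lineForm_sq]
  rcases h with h | h | h
  · have h : dist x z + dist z y = dist x y := h
    have := one_add_two_mul_cosh_eq (dist z x) (dist z y) (dist x y)
    rw [dist_comm z x, h, dist_comm x z] at this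
    linarith
  · have h : dist z x + dist x y = dist z y := h
    have := one_add_two_mul_cosh_eq (dist z x) (dist x y) (dist z y)
    rw [h] at this
    linarith
  · have h : dist x y + dist y z = dist x z := h
    have := one_add_two_mul_cosh_eq (dist x y) (dist y z) (dist x z)
    rw [h, dist_comm x z, dist_comm y z] at this
    linarith

theorem lineForm_ne_zero {x y z : ℍ} (h₁ : dist x y < dist z x + dist z y)
    (h₂ : dist z x < dist x y + dist z y) (h₃ : dist z y < dist z x + dist x y) :
    lineForm x y z ≠ 0 := by
  rw [← sq_pos_iff, lineForm_sq]
  have := one_add_two_mul_cosh_eq (dist z x) (dist z y) (dist x y)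
  have h4 : 0 < (Real.cosh (dist z x + dist z y) - Real.cosh (dist x y)) *
      (Real.cosh (dist x y) - Real.cosh (dist z x - dist z y)) := by
    apply mul_pos
    · rw [sub_pos, Real.cosh_lt_cosh, abs_of_nonneg dist_nonneg, abs_of_nonneg (by positivity)]
      exact h₁
    · rw [sub_pos, Real.cosh_lt_cosh, abs_of_nonneg (dist_nonneg (x := x)), abs_lt]
      constructor <;> linarith
  linarith

theorem cosh_eq_one_add_two_mul_sinh_half_sq (t : ℝ) :
    Real.cosh t = 1 + 2 * Real.sinh (t / 2) ^ 2 := by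
  have := Real.cosh_two_mul (t / 2)
  rw [mul_div_cancel₀ t two_ne_zero, Real.cosh_sq] at this
  linarith

theorem diamForm_eq (x y z : ℍ) : diamForm x y z = 2 * (Real.sinh (dist z x / 2) ^ 2 +
    Real.sinh (dist z y / 2) ^ 2 - Real.sinh (dist x y / 2) ^ 2) := by
  simp only [diamForm, cosh_eq_one_add_two_mul_sinh_half_sq (dist _ _)]
  ring

/-- The last factor is Heron's product up to sign: it is negative exactly when the three
half-distance `sinh` satisfy the strict triangle inequalities. This links side lengths to the
pencil. -/
theorem diamForm_sq_sub_lineForm_sq (x y z : ℍ) :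
    Real.sinh (dist x y / 2) ^ 2 * diamForm x y z ^ 2 - lineForm x y z ^ 2 =
    4 * (1 + Real.sinh (dist x y / 2) ^ 2) * ((Real.sinh (dist x y / 2) ^ 2 -
      Real.sinh (dist z x / 2) ^ 2 - Real.sinh (dist z y / 2) ^ 2) ^ 2 -
      (2 * (Real.sinh (dist z x / 2) * Real.sinh (dist z y / 2))) ^ 2) := by
  rw [diamForm_eq, lineForm_sq]
  simp only [cosh_eq_one_add_two_mul_sinh_half_sq (dist _ _)]
  ring

/-- The affine forms that vanish at `x` and `y` are spanned by `diamForm x y` and `lineForm x y`;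
the discriminant of such a form is diagonal in this basis. -/
theorem exists_form_eq_diamForm_add_lineForm {x y : ℍ} (hxy : x ≠ y) {a b c d : ℝ}
    (hx : cycleForm a b c d x = 0) (hy : cycleForm a b c d y = 0) :
    ∃ l m : ℝ, (∀ z, cycleForm a b c d z = z.im * (l * diamForm x y z + m * lineForm x y z)) ∧
      b ^ 2 - 4 * a * d = 2 * (1 + Real.cosh (dist x y)) *
        (Real.sinh (dist x y / 2) ^ 2 * m ^ 2 - l ^ 2) ∧
      (l = 0 → m = 0 → a = 0 ∧ b = 0 ∧ c = 0 ∧ d = 0) := by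
  rw [cycleForm_eq_coord, mul_eq_zero, or_iff_right x.im_pos.ne'] at hx
  rw [cycleForm_eq_coord, mul_eq_zero, or_iff_right y.im_pos.ne'] at hy
  have hC := cosh_dist_eq_coord x y
  have hC1 : 1 < Real.cosh (dist x y) := by
    rw [Real.one_lt_cosh]
    exact dist_ne_zero.2 hxy
  have hs := cosh_eq_one_add_two_mul_sinh_half_sq (dist x y)
  have hx1 := coordP_mul_coordR x
  have hy1 := coordP_mul_coordR y
  simp only [cycleForm_eq_coord, diamForm, cosh_dist_eq_coord _ x, cosh_dist_eq_coord _ y,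
    lineForm]
  rw [← hC]
  generalize Real.cosh (dist x y) = C at *
  generalize Real.sinh (dist x y / 2) = s at *
  generalize coordP x = p at *
  generalize coordQ x = q at *
  generalize coordR x = r at *
  generalize coordP y = p' at *
  generalize coordQ y = q' at *
  generalize coordR y = r' at *
  -- `A, B, D` are the coefficients of `lineForm`.
  obtain ⟨A, hA⟩ : ∃ A, A = (p * q' - q * p') / 2 := ⟨_, rfl⟩
  obtain ⟨B, hB⟩ : ∃ B, B = (r * p' - p * r') / 2 := ⟨_, rfl⟩
  obtain ⟨D, hD⟩ : ∃ D, D = (q * r' - r * q') / 2 := ⟨_, rfl⟩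
  have hdisc : B ^ 2 - 4 * A * D = C ^ 2 - 1 := by
    subst hA hB hD
    rw [hC]
    linear_combination (-1 : ℝ) * hx1 - p * r * hy1 + q ^ 2 * hy1
  -- `lineForm` has no constant term and that of `diamForm` is `-(1 + C)`, so `c` determines `l`.
  -- The remainder `(wa, wb, wd)` is linear and vanishes at `x` and `y`, hence is a multiple of `(A,
  -- B, D)`.
  obtain ⟨l, hl⟩ : ∃ l, l * (1 + C) = -c := ⟨-c / (1 + C), by field_simp⟩
  obtain ⟨wa, hwa⟩ : ∃ wa, wa = a - l * ((p + p') / 2) := ⟨_, rfl⟩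
  obtain ⟨wb, hwb⟩ : ∃ wb, wb = b + l * (q + q') := ⟨_, rfl⟩
  obtain ⟨wd, hwd⟩ : ∃ wd, wd = d - l * ((r + r') / 2) := ⟨_, rfl⟩
  have hwx : wa * r + wb * q + wd * p = 0 := by
    subst hwa hwb hwd
    linear_combination hx - l * hx1 - hl + l * hC
  have hwy : wa * r' + wb * q' + wd * p' = 0 := by
    subst hwa hwb hwd
    linear_combination hy - l * hy1 - hl + l * hC
  have hn : A ^ 2 + B ^ 2 + D ^ 2 ≠ 0 := by
    intro h0
    have hA0 : A = 0 := by nlinarith [sq_nonneg A, sq_nonneg B, sq_nonneg D]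
    have hB0 : B = 0 := by nlinarith [sq_nonneg A, sq_nonneg B, sq_nonneg D]
    rw [hA0, hB0] at hdisc
    nlinarith
  have h1 : wa * B = wb * A := by
    subst hA hB
    linear_combination (p' * hwx - p * hwy) / 2
  have h2 : wb * D = wd * B := by
    subst hB hD
    linear_combination (r' * hwx - r * hwy) / 2
  have h3 : wd * A = wa * D := by
    subst hA hD
    linear_combination (q' * hwx - q * hwy) / 2
  obtain ⟨m, hm⟩ : ∃ m, m * (A ^ 2 + B ^ 2 + D ^ 2) = wa * A + wb * B + wd * D :=
    ⟨_, div_mul_cancel₀ _ hn⟩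
  have ha : a = l * ((p + p') / 2) + m * A := by
    have : (wa - m * A) * (A ^ 2 + B ^ 2 + D ^ 2) = 0 := by
      linear_combination -A * hm + B * h1 - D * h3
    have := (mul_eq_zero.1 this).resolve_right hn
    linarith
  have hb : b = -l * (q + q') + m * B := by
    have : (wb - m * B) * (A ^ 2 + B ^ 2 + D ^ 2) = 0 := by
      linear_combination -B * hm - A * h1 + D * h2
    have := (mul_eq_zero.1 this).resolve_right hn
    linarith
  have hd : d = l * ((r + r') / 2) + m * D := by
    have : (wd - m * D) * (A ^ 2 + B ^ 2 + D ^ 2) = 0 := by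
      linear_combination -D * hm - B * h2 + A * h3
    have := (mul_eq_zero.1 this).resolve_right hn
    linarith
  have hc : c = -l * (1 + C) := by linarith
  refine ⟨l, m, fun z => ?_, ?_, ?_⟩
  · rw [ha, hb, hc, hd, hA, hB, hD]
    ring
  · have hcross : (q + q') * B + (p + p') * D + (r + r') * A = 0 := by
      subst hA hB hD
      ring
    rw [ha, hb, hd]
    linear_combination m ^ 2 * hdisc - 2 * l * m * hcross - l ^ 2 * hx1 - l ^ 2 * hy1
      + 2 * l ^ 2 * hC + m ^ 2 * (1 + C) * hs
  · rintro rfl rfl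
    simp [ha, hb, hc, hd]

/-- On the open segment between its end points, the line form vanishes and the diameter form is
negative. -/
theorem exists_mem_segment_diamForm_neg {x y : ℍ} (hxy : x ≠ y) :
    ∃ z ∈ segment x y, lineForm x y z = 0 ∧ diamForm x y z < 0 := by
  have hC := cosh_dist_eq_coord x y
  have hx1 := coordP_mul_coordR x
  have hy1 := coordP_mul_coordR y
  have hl : 0 < dist x y := dist_pos.2 hxy
  have hk : 0 < Real.cosh (dist x y / 2) := Real.cosh_pos _
  have h2 : Real.cosh (dist x y) = 2 * Real.cosh (dist x y / 2) ^ 2 - 1 := by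
    have := Real.cosh_two_mul (dist x y / 2)
    rw [mul_div_cancel₀ _ two_ne_zero, Real.sinh_sq] at this
    linarith
  obtain ⟨k, hkdef⟩ : ∃ k, k = Real.cosh (dist x y / 2) := ⟨_, rfl⟩
  rw [← hkdef] at h2 hk
  -- The midpoint: `x + y` has Minkowski norm squared `2 + 2 * C = (2 * k) ^ 2`.
  obtain ⟨z, hp, hq, hr⟩ := exists_coord (p := (coordP x + coordP y) / (2 * k))
    (q := (coordQ x + coordQ y) / (2 * k)) (r := (coordR x + coordR y) / (2 * k))
    (by have := coordP_pos x; have := coordP_pos y; positivity)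
    (by
      field_simp
      linear_combination hx1 + hy1 - 2 * hC + 2 * h2)
  have hzx : dist z x = dist x y / 2 := by
    refine Real.cosh_strictMonoOn.injOn (Set.mem_Ici.2 dist_nonneg)
      (Set.mem_Ici.2 (by positivity)) ?_
    rw [← hkdef, cosh_dist_eq_coord z x, hp, hq, hr]
    field_simp
    linear_combination 2 * hx1 - 2 * hC + 2 * h2
  have hzy : dist z y = dist x y / 2 := by
    refine Real.cosh_strictMonoOn.injOn (Set.mem_Ici.2 dist_nonneg)
      (Set.mem_Ici.2 (by positivity)) ?_
    rw [← hkdef, cosh_dist_eq_coord z y, hp, hq, hr]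
    field_simp
    linear_combination 2 * hy1 - 2 * hC + 2 * h2
  have hz : z ∈ segment x y := by
    change dist x z + dist z y = dist x y
    rw [dist_comm x z, hzx, hzy]
    ring
  refine ⟨z, hz, lineForm_eq_zero_of_mem_line (Or.inl hz), ?_⟩
  have : 1 < k := by
    rw [hkdef, Real.one_lt_cosh]
    positivity
  rw [diamForm, hzx, hzy, h2, ← hkdef]
  nlinarith

/-- The line form has opposite signs on the two sides of the line. -/
theorem lineForm_mul_nonpos_of_oppositeSides {x y u v : ℍ} (h : OppositeSides x y u v)
    (hu : lineForm x y u ≠ 0) : lineForm x y u * lineForm x y v ≤ 0 := by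
  obtain ⟨z, hzl, hz⟩ := h
  have hz0 := lineForm_eq_zero_of_mem_line hzl
  obtain ⟨h1, h2, h3⟩ := sinh_mul_coord_of_mem_segment hz
  have key : Real.sinh (dist z v) * lineForm x y u + Real.sinh (dist u z) * lineForm x y v = 0 := by
    have : Real.sinh (dist u v) * lineForm x y z =
        Real.sinh (dist z v) * lineForm x y u + Real.sinh (dist u z) * lineForm x y v := by
      unfold lineForm
      linear_combination ((coordP x * coordQ y - coordQ x * coordP y) * h3 +
        (coordR x * coordP y - coordP x * coordR y) * h2 +
        (coordQ x * coordR y - coordR x * coordQ y) * h1) / 2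
    rw [← this, hz0, mul_zero]
  have hzv : 0 ≤ Real.sinh (dist z v) := Real.sinh_nonneg_iff.2 dist_nonneg
  have huz : 0 < Real.sinh (dist u z) := by
    refine Real.sinh_pos_iff.2 (dist_pos.2 ?_)
    rintro rfl
    exact hu hz0
  have : Real.sinh (dist u z) * (lineForm x y u * lineForm x y v) ≤ 0 := by
    have : Real.sinh (dist u z) * (lineForm x y u * lineForm x y v) =
      -(Real.sinh (dist z v) * lineForm x y u ^ 2) := by linear_combination lineForm x y u * key
    rw [this]
    have := mul_nonneg hzv (sq_nonneg (lineForm x y u))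
    linarith
  by_contra! hc
  have := mul_pos huz hc
  linarith

/-! ### Crossing a long side -/

theorem continuous_cycleForm (a b c d : ℝ) : Continuous (cycleForm a b c d) := by
  unfold cycleForm
  have h1 : Continuous fun z : ℍ => Complex.normSq (z : ℂ) :=
    Complex.continuous_normSq.comp UpperHalfPlane.continuous_coe
  have h2 := UpperHalfPlane.continuous_re
  have h3 := UpperHalfPlane.continuous_im
  fun_prop

theorem cycleForm_nonneg_of_notMem_interior {a b c d : ℝ} {z : ℍ}
    (h : z ∉ interior {z | cycleForm a b c d z ≤ 0}) : 0 ≤ cycleForm a b c d z := by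
  by_contra! hc
  refine h (mem_interior.2 ⟨{z | cycleForm a b c d z < 0}, fun w hw => Set.mem_ofPred.2 (le_of_lt hw), ?_, hc⟩)
  exact isOpen_lt (continuous_cycleForm a b c d) continuous_const

/-- Transfer of the non-compactness condition `n ^ 2 ≤ s ^ 2 * t ^ 2` across a line: `t, n` and
`t', n'` are the values of the diameter form and of the line form on the two sides of it. -/
theorem pos_and_sq_le_of_opposite {l m t n t' n' s : ℝ} (hl : 0 < l) (h : l * t + m * n = 0)
    (h' : 0 ≤ l * t' + m * n') (hn : n * n' < 0) (ht : t < 0) (hs : n ^ 2 ≤ s ^ 2 * t ^ 2) :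
    0 < t' ∧ n' ^ 2 ≤ s ^ 2 * t' ^ 2 := by
  have hn0 : n ≠ 0 := by rintro rfl; simp at hn
  obtain ⟨ρ, hρ⟩ : ∃ ρ, n' = -ρ * n := ⟨-(n' / n), by field_simp⟩
  have hρ0 : 0 < ρ := by
    subst hρ
    have : 0 < n ^ 2 := by positivity
    by_contra! hc
    nlinarith
  -- Adding `ρ` times `h` to `h'` eliminates `m`.
  have ht' : ρ * (-t) ≤ t' := by
    have : 0 ≤ l * (t' + ρ * t) := by
      subst hρ
      linarith [congrArg (ρ * ·) h, mul_zero ρ]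
    have := nonneg_of_mul_nonneg_right this hl
    linarith
  have h0 : 0 < ρ * (-t) := mul_pos hρ0 (by linarith)
  refine ⟨by linarith, ?_⟩
  calc n' ^ 2 = ρ ^ 2 * n ^ 2 := by rw [hρ]; ring
    _ ≤ ρ ^ 2 * (s ^ 2 * t ^ 2) := by gcongr
    _ = s ^ 2 * (ρ * (-t)) ^ 2 := by ring
    _ ≤ s ^ 2 * t' ^ 2 := by gcongr

theorem left_mem_line (x y : ℍ) : x ∈ line x y := by
  left
  simp [segment]

theorem right_mem_line (x y : ℍ) : y ∈ line x y := by
  left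
  simp [segment]

/-- The side `x y` of the triangle `u x y` is so long that the circumcircle of the triangle is not
compact. -/
def IsLongSide (u x y : ℍ) : Prop :=
  Real.sinh (dist u x / 2) + Real.sinh (dist u y / 2) ≤ Real.sinh (dist x y / 2)

theorem sinh_half_dist_pos {x y : ℍ} (h : x ≠ y) : 0 < Real.sinh (dist x y / 2) := by
  have := dist_pos.2 h
  exact Real.sinh_pos_iff.2 (by positivity)

theorem sinh_half_dist_nonneg (x y : ℍ) : 0 ≤ Real.sinh (dist x y / 2) :=
  Real.sinh_nonneg_iff.2 (by positivity)

/-- Crossing the long side of a Delaunay triangle leads to a triangle with a longer long side. -/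
theorem isLongSide_of_delaunay {x y u v : ℍ} (hxy : x ≠ y) {a b c d : ℝ}
    (h0 : ¬ (a = 0 ∧ b = 0 ∧ c = 0 ∧ d = 0)) (hx : cycleForm a b c d x = 0)
    (hy : cycleForm a b c d y = 0) (hu : cycleForm a b c d u = 0)
    (hconv : IsConvex {z | cycleForm a b c d z ≤ 0})
    (hv : v ∉ interior {z | cycleForm a b c d z ≤ 0}) (hopp : OppositeSides x y u v)
    (hNu : lineForm x y u ≠ 0) (hNv : lineForm x y v ≠ 0) (hlong : IsLongSide u x y) :
    IsLongSide y x v ∨ IsLongSide x y v := by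
  obtain ⟨l, m, hF, -, hlm⟩ := exists_form_eq_diamForm_add_lineForm hxy hx hy
  have hsgn := lineForm_mul_nonpos_of_oppositeSides hopp hNu
  have hNN : lineForm x y u * lineForm x y v < 0 :=
    lt_of_le_of_ne hsgn (mul_ne_zero hNu hNv)
  have hu' : l * diamForm x y u + m * lineForm x y u = 0 := by
    rw [hF] at hu
    exact (mul_eq_zero.1 hu).resolve_left u.im_pos.ne'
  have hv' : 0 ≤ l * diamForm x y v + m * lineForm x y v := by
    have := cycleForm_nonneg_of_notMem_interior hv
    rw [hF] at this
    exact nonneg_of_mul_nonneg_right this v.im_pos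
  have hl0 : l ≠ 0 := by
    rintro rfl
    have hm : m = 0 := by simpa [hNu] using hu'
    exact h0 (hlm rfl hm)
  -- Convexity selects the sign of the form: the midpoint of `x y` lies in the ball, where
  -- `lineForm` is zero and `diamForm` negative.
  have hl : 0 < l := by
    obtain ⟨z, hz, hNz, hTz⟩ := exists_mem_segment_diamForm_neg hxy
    have hz' : cycleForm a b c d z ≤ 0 :=
      hconv x (Set.mem_ofPred.2 hx.le) y (Set.mem_ofPred.2 hy.le) hz
    rw [hF, hNz, mul_zero, add_zero] at hz'
    have h1 : l * diamForm x y z ≤ 0 := nonpos_of_mul_nonpos_right hz' z.im_pos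
    refine lt_of_le_of_ne ?_ hl0.symm
    by_contra! hc
    have := mul_pos_of_neg_of_neg hc hTz
    linarith
  have hux : u ≠ x := by
    rintro rfl
    exact hNu (lineForm_eq_zero_of_mem_line (left_mem_line _ _))
  have huy : u ≠ y := by
    rintro rfl
    exact hNu (lineForm_eq_zero_of_mem_line (right_mem_line _ _))
  have hp := sinh_half_dist_pos hux
  have hq := sinh_half_dist_pos huy
  have hs := sinh_half_dist_pos hxy
  have hp' := sinh_half_dist_nonneg v x
  have hq' := sinh_half_dist_nonneg v y
  have hIu := diamForm_sq_sub_lineForm_sq x y u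
  have hIv := diamForm_sq_sub_lineForm_sq x y v
  have hTu := diamForm_eq x y u
  have hTv := diamForm_eq x y v
  unfold IsLongSide at *
  rw [dist_comm y x, dist_comm y v, dist_comm x v]
  generalize Real.sinh (dist x y / 2) = s at *
  generalize Real.sinh (dist u x / 2) = p at *
  generalize Real.sinh (dist u y / 2) = q at *
  generalize Real.sinh (dist v x / 2) = p' at *
  generalize Real.sinh (dist v y / 2) = q' at *
  have hsq : (p + q) ^ 2 ≤ s ^ 2 := by gcongr
  have hpq : 0 < p * q := mul_pos hp hq
  have hH : (2 * (p * q)) ^ 2 ≤ (s ^ 2 - p ^ 2 - q ^ 2) ^ 2 := by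
    have : 2 * (p * q) ≤ s ^ 2 - p ^ 2 - q ^ 2 := by linarith
    gcongr
  obtain ⟨hT, hN⟩ := pos_and_sq_le_of_opposite hl hu' hv' hNN (s := s) (by linarith) (by
    have := mul_nonneg (a := 4 * (1 + s ^ 2)) (by positivity) (sub_nonneg.2 hH)
    linarith)
  -- `diamForm` is positive at `v`, so the square root of this inequality reads `s ≤ |p' - q'|`: the
  -- side `v x` or `v y` is long.
  have hH' : (2 * (p' * q')) ^ 2 ≤ (p' ^ 2 + q' ^ 2 - s ^ 2) ^ 2 := by
    have h1 : 0 ≤ 4 * (1 + s ^ 2) *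
        ((s ^ 2 - p' ^ 2 - q' ^ 2) ^ 2 - (2 * (p' * q')) ^ 2) := by linarith
    have := nonneg_of_mul_nonneg_right h1 (by positivity)
    linarith [sub_sq_comm (s ^ 2) (p' ^ 2 + q' ^ 2), sub_sub (s ^ 2) (p' ^ 2) (q' ^ 2)]
  have h2 := (sq_le_sq₀ (by positivity) (by linarith)).1 hH'
  have h3 : s ^ 2 ≤ (p' - q') ^ 2 := by linarith
  have h4 := sq_le_sq.1 h3
  rw [abs_of_pos hs, le_abs] at h4
  rcases h4 with h4 | h4
  · left; linarith
  · right; linarith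

/-! ### Compactness from the absence of long sides -/

/-- The circumcircle of a triangle without a long side has negative discriminant. -/
theorem discrim_neg_of_not_isLongSide {x y u : ℍ} (hxy : x ≠ y) {a b c d : ℝ}
    (h0 : ¬ (a = 0 ∧ b = 0 ∧ c = 0 ∧ d = 0)) (hx : cycleForm a b c d x = 0)
    (hy : cycleForm a b c d y = 0) (hu : cycleForm a b c d u = 0)
    (hNu : lineForm x y u ≠ 0) (h₁ : ¬ IsLongSide u x y) (h₂ : ¬ IsLongSide x y u)
    (h₃ : ¬ IsLongSide y x u) : b ^ 2 - 4 * a * d < 0 := by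
  obtain ⟨l, m, hF, hdisc, hlm⟩ := exists_form_eq_diamForm_add_lineForm hxy hx hy
  have hu' : l * diamForm x y u + m * lineForm x y u = 0 := by
    rw [hF] at hu
    exact (mul_eq_zero.1 hu).resolve_left u.im_pos.ne'
  have hl0 : l ≠ 0 := by
    rintro rfl
    have hm : m = 0 := by simpa [hNu] using hu'
    exact h0 (hlm rfl hm)
  have hI := diamForm_sq_sub_lineForm_sq x y u
  have hs := sinh_half_dist_pos hxy
  have hp := sinh_half_dist_nonneg u x
  have hq := sinh_half_dist_nonneg u y
  have hC := Real.cosh_pos (dist x y)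
  unfold IsLongSide at *
  rw [dist_comm x u] at h₂ h₃
  rw [dist_comm y u] at h₂ h₃
  rw [dist_comm y x] at h₃
  generalize Real.sinh (dist x y / 2) = s at *
  generalize Real.sinh (dist u x / 2) = p at *
  generalize Real.sinh (dist u y / 2) = q at *
  have hH : (s ^ 2 - p ^ 2 - q ^ 2) ^ 2 - (2 * (p * q)) ^ 2 < 0 := by
    have : (s ^ 2 - p ^ 2 - q ^ 2) ^ 2 - (2 * (p * q)) ^ 2 =
      -((s + p + q) * (p + q - s) * ((s + p - q) * (s + q - p))) := by ring
    rw [this, neg_lt_zero]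
    have e1 : 0 < p + q - s := by linarith
    have e2 : 0 < s + p - q := by linarith
    have e3 : 0 < s + q - p := by linarith
    positivity
  have hlt : s ^ 2 * diamForm x y u ^ 2 < lineForm x y u ^ 2 := by
    have := mul_neg_of_pos_of_neg (a := 4 * (1 + s ^ 2)) (by positivity) hH
    linarith
  -- The relation `l * diamForm = -m * lineForm` at `u` turns `hlt` into a bound on the
  -- coefficients.
  have hml : s ^ 2 * m ^ 2 < l ^ 2 := by
    rcases eq_or_ne m 0 with rfl | hm
    · simp only [ne_eq, OfNat.ofNat_ne_zero, not_false_eq_true, zero_pow, mul_zero]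
      positivity
    by_contra! hc
    have e1 : l ^ 2 * diamForm x y u ^ 2 = m ^ 2 * lineForm x y u ^ 2 := by
      linear_combination (l * diamForm x y u - m * lineForm x y u) * hu'
    have e2 := mul_le_mul_of_nonneg_right hc (sq_nonneg (diamForm x y u))
    have e3 := mul_lt_mul_of_pos_left hlt (show 0 < m ^ 2 by positivity)
    linarith
  rw [hdisc]
  exact mul_neg_of_pos_of_neg (by positivity) (by linarith)

/-- A cycle with negative discriminant and at least two points is a hyperbolic circle. -/
theorem exists_eq_sphere_of_discrim_neg {a b c d : ℝ} (h : b ^ 2 - 4 * a * d < 0) {x y : ℍ}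
    (hxy : x ≠ y) (hx : cycleForm a b c d x = 0) (hy : cycleForm a b c d y = 0) :
    ∃ (p : ℍ) (r : ℝ), 0 < r ∧ {z | cycleForm a b c d z = 0} = Metric.sphere p r := by
  have ha : a ≠ 0 := by
    rintro rfl
    nlinarith [sq_nonneg b]
  have he : 0 < (4 * a * d - b ^ 2) / (4 * a ^ 2) := div_pos (by linarith) (by positivity)
  obtain ⟨e, hepos, he2⟩ : ∃ e : ℝ, 0 < e ∧ e ^ 2 = (4 * a * d - b ^ 2) / (4 * a ^ 2) :=
    ⟨_, Real.sqrt_pos.2 he, Real.sq_sqrt he.le⟩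
  obtain ⟨p, hpre, hpim⟩ : ∃ p : ℍ, p.re = -b / (2 * a) ∧ p.im = e :=
    ⟨⟨⟨-b / (2 * a), e⟩, hepos⟩, rfl, rfl⟩
  -- Completing the square, with `-b / (2 * a) + i * e` as hyperbolic centre.
  have key : ∀ z : ℍ, cycleForm a b c d z =
      2 * a * e * z.im * (Real.cosh (dist z p) - -c / (2 * a * e)) := by
    intro z
    have := z.im_pos.ne'
    have hd : d = a * e ^ 2 + b ^ 2 / (4 * a) := by
      rw [he2]
      field_simp
      ring
    rw [UpperHalfPlane.cosh_dist', hpre, hpim, hd]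
    unfold cycleForm
    rw [Complex.normSq_apply, UpperHalfPlane.coe_re, UpperHalfPlane.coe_im]
    field_simp
    ring
  have hiff : ∀ z : ℍ, cycleForm a b c d z = 0 ↔ Real.cosh (dist z p) = -c / (2 * a * e) := by
    intro z
    have := z.im_pos.ne'
    rw [key, mul_eq_zero, sub_eq_zero, or_iff_right (by positivity)]
  have hsph : ∀ z : ℍ, cycleForm a b c d z = 0 ↔ dist z p = dist x p := by
    intro z
    rw [hiff, ← (hiff x).1 hx]
    exact Real.cosh_strictMonoOn.injOn.eq_iff (Set.mem_Ici.2 dist_nonneg)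
      (Set.mem_Ici.2 dist_nonneg)
  refine ⟨p, dist x p, dist_pos.2 ?_, Set.ext hsph⟩
  rintro rfl
  have := (hsph y).1 hy
  rw [dist_self, dist_eq_zero] at this
  exact hxy this.symm

/-! ### Longest long side on the glued surface -/

namespace Triangle

theorem vertex_ne (T : Triangle) {i j k : Fin 3} (hij : i ≠ j) (hjk : j ≠ k) (hik : i ≠ k) :
    T.vertex i ≠ T.vertex j := by
  intro h
  have := T.nondegenerate i j k hij hjk hik
  rw [h, dist_self, zero_add] at this
  exact lt_irrefl _ this

theorem lineForm_vertex_ne_zero (T : Triangle) {i j k : Fin 3} (hij : i ≠ j) (hjk : j ≠ k)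
    (hik : i ≠ k) : lineForm (T.vertex j) (T.vertex k) (T.vertex i) ≠ 0 := by
  refine lineForm_ne_zero ?_ ?_ ?_
  · rw [dist_comm (T.vertex i) (T.vertex j)]
    exact T.nondegenerate j i k hij.symm hik hjk
  · rw [dist_comm (T.vertex i) (T.vertex j), dist_comm (T.vertex i) (T.vertex k)]
    exact T.nondegenerate j k i hjk hik.symm hij.symm
  · exact T.nondegenerate i j k hij hjk hik

end Triangle

theorem IsLongSide.symm {u x y : ℍ} (h : IsLongSide u x y) : IsLongSide u y x := by
  unfold IsLongSide at *
  rw [dist_comm y x]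
  linarith

theorem IsLongSide.dist_lt {u x y : ℍ} (h : IsLongSide u x y) (hux : u ≠ x) :
    dist u y < dist x y := by
  have := sinh_half_dist_pos hux
  unfold IsLongSide at h
  have : Real.sinh (dist u y / 2) < Real.sinh (dist x y / 2) := by linarith
  linarith [Real.sinh_lt_sinh.1 this]

theorem isLongSide_isometry_iff (g : ℍ ≃ᵢ ℍ) (u x y : ℍ) :
    IsLongSide (g u) (g x) (g y) ↔ IsLongSide u x y := by
  simp only [IsLongSide, g.dist_eq]

theorem eq_add_one_or_eq_add_two : ∀ i j k : Fin 3, i ≠ j → j ≠ k → i ≠ k →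
    (j = i + 1 ∧ k = i + 2) ∨ (k = i + 1 ∧ j = i + 2) := by
  decide

variable {S : Type*} [MetricSpace S] {V : Set S}

theorem GeodesicTriangulation.IsDelaunay.exists_longer {T : GeodesicTriangulation S V}
    (hT : T.IsDelaunay) {t : T.Face} {i j k : Fin 3} (hij : i ≠ j) (hjk : j ≠ k) (hik : i ≠ k)
    (h : IsLongSide ((T.tri t).vertex i) ((T.tri t).vertex j) ((T.tri t).vertex k)) :
    ∃ (t' : T.Face) (i' j' k' : Fin 3), i' ≠ j' ∧ j' ≠ k' ∧ i' ≠ k' ∧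
      IsLongSide ((T.tri t').vertex i') ((T.tri t').vertex j') ((T.tri t').vertex k') ∧
      dist ((T.tri t).vertex j) ((T.tri t).vertex k) <
        dist ((T.tri t').vertex j') ((T.tri t').vertex k') := by
  -- `IsLift` fixes the order `i + 1, i + 2` of the edge's end points; being long is symmetric in
  -- them.
  wlog hjk' : j = i + 1 ∧ k = i + 2 generalizing j k
  · have := this hik hjk.symm hij h.symm
      ((eq_add_one_or_eq_add_two i j k hij hjk hik).resolve_left hjk')
    rwa [dist_comm ((T.tri t).vertex k)] at this
  obtain ⟨B, g, ⟨⟨a, b, c, d, h0, hv, rfl⟩, hconv⟩, ⟨hg, hopp⟩, hB⟩ := hT t i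
  rw [← hjk'.1, ← hjk'.2] at hopp
  have hgj := hg j hij.symm
  have hgk := hg k hik.symm
  have hB := hB (T.perm t i i)
  have hij' := (T.perm t i).injective.ne hij
  have hjk'' := (T.perm t i).injective.ne hjk
  have hik' := (T.perm t i).injective.ne hik
  have hNv : lineForm ((T.tri t).vertex j) ((T.tri t).vertex k)
      (g ((T.tri (T.next t i)).vertex (T.perm t i i))) ≠ 0 := by
    have := (T.tri (T.next t i)).nondegenerate
    rw [← hgj, ← hgk]
    refine lineForm_ne_zero ?_ ?_ ?_
    · simp only [g.dist_eq]
      rw [dist_comm (Triangle.vertex _ (T.perm t i i)) (Triangle.vertex _ (T.perm t i j))]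
      exact this _ _ _ hij'.symm hik' hjk''
    · simp only [g.dist_eq]
      rw [dist_comm (Triangle.vertex _ (T.perm t i i)) (Triangle.vertex _ (T.perm t i j)),
        dist_comm (Triangle.vertex _ (T.perm t i i)) (Triangle.vertex _ (T.perm t i k))]
      exact this _ _ _ hjk'' hik'.symm hij'.symm
    · simp only [g.dist_eq]
      exact this _ _ _ hij' hjk'' hik'
  have hlong := isLongSide_of_delaunay ((T.tri t).vertex_ne hjk hik.symm hij.symm) h0 (hv j) (hv k)
    (hv i) hconv hB hopp ((T.tri t).lineForm_vertex_ne_zero hij hjk hik) hNv h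
  -- Undoing the lift `g` expresses everything in the neighbour's own vertices.
  rw [← hgj, ← hgk, isLongSide_isometry_iff, isLongSide_isometry_iff, g.dist_eq] at *
  rcases hlong with hlong | hlong
  · refine ⟨_, _, _, _, hjk''.symm, hij'.symm, hik'.symm, hlong, ?_⟩
    have := hlong.symm.dist_lt ((T.tri (T.next t i)).vertex_ne hik'.symm hij' hjk''.symm)
    rwa [dist_comm, dist_comm (Triangle.vertex _ (T.perm t i i))] at this
  · refine ⟨_, _, _, _, hjk'', hik'.symm, hij'.symm, hlong, ?_⟩
    have := hlong.symm.dist_lt ((T.tri (T.next t i)).vertex_ne hij'.symm hik' hjk'')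
    rwa [dist_comm (Triangle.vertex _ (T.perm t i i))] at this

/-- By finiteness some long side has maximal length, which `exists_longer` contradicts. -/
theorem GeodesicTriangulation.IsDelaunay.not_isLongSide {T : GeodesicTriangulation S V}
    (hT : T.IsDelaunay) {t : T.Face} {i j k : Fin 3} (hij : i ≠ j) (hjk : j ≠ k) (hik : i ≠ k) :
    ¬ IsLongSide ((T.tri t).vertex i) ((T.tri t).vertex j) ((T.tri t).vertex k) := by
  intro h
  have := T.finite_face
  let s : Set (T.Face × Fin 3 × Fin 3 × Fin 3) := {q | q.2.1 ≠ q.2.2.1 ∧ q.2.2.1 ≠ q.2.2.2 ∧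
    q.2.1 ≠ q.2.2.2 ∧ IsLongSide ((T.tri q.1).vertex q.2.1) ((T.tri q.1).vertex q.2.2.1)
      ((T.tri q.1).vertex q.2.2.2)}
  obtain ⟨q, ⟨h1, h2, h3, h4⟩, hmax⟩ := s.toFinite.exists_maximalFor
    (fun q => dist ((T.tri q.1).vertex q.2.2.1) ((T.tri q.1).vertex q.2.2.2)) s
    ⟨(t, i, j, k), hij, hjk, hik, h⟩
  obtain ⟨t', i', j', k', h1', h2', h3', h4', hlt⟩ := hT.exists_longer h1 h2 h3 h4
  exact absurd (hmax (j := (t', i', j', k')) ⟨h1', h2', h3', h4'⟩ hlt.le) (not_le.2 hlt)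

end HyperbolicPolyhedral

theorem theorem2p5 {S : Type*} [MetricSpace S] (V : Set S)
    (hS : HyperbolicPolyhedral.IsClosedHyperbolicPolyhedralSurface S V)
    (T : HyperbolicPolyhedral.GeodesicTriangulation S V) (hT : T.IsDelaunay) (t : T.Face) :
    (∃ C : Set ℍ, (T.tri t).IsCircumcircle C) ∧
      ∀ C : Set ℍ, (T.tri t).IsCircumcircle C →
        IsCompact C ∧ ∃ (p : ℍ) (r : ℝ), 0 < r ∧ C = Metric.sphere p r := by
  constructor
  · obtain ⟨-, -, ⟨⟨a, b, c, d, h0, hv, -⟩, -⟩, -⟩ := hT t 0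
    exact ⟨_, a, b, c, d, h0, hv, rfl⟩
  · rintro C ⟨a, b, c, d, h0, hv, rfl⟩
    have h12 : (T.tri t).vertex 1 ≠ (T.tri t).vertex 2 :=
      (T.tri t).vertex_ne (k := 0) (by decide) (by decide) (by decide)
    have hdisc := HyperbolicPolyhedral.discrim_neg_of_not_isLongSide h12 h0 (hv 1) (hv 2) (hv 0)
      ((T.tri t).lineForm_vertex_ne_zero (by decide) (by decide) (by decide))
      (hT.not_isLongSide (by decide) (by decide) (by decide))
      (hT.not_isLongSide (by decide) (by decide) (by decide))
      (hT.not_isLongSide (by decide) (by decide) (by decide))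
    obtain ⟨p, r, hr, hC⟩ :=
      HyperbolicPolyhedral.exists_eq_sphere_of_discrim_neg hdisc h12 (hv 1) (hv 2)
    exact ⟨hC ▸ isCompact_sphere p r, p, r, hr, hC⟩
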